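/- Call a real number $\alpha$ Liouville if for every $n \in \mathbb{N}$ there are integers $p, q$ with $q > 1$ and $\left|\alpha - \frac{p}{q}\right| \le q^{-n}$ (so every rational number is Liouville), and non-Liouville otherwise. Let $P \in \mathbb{R}[x]$ be a polynomial whose coefficient of $x$ is non-Liouville. For an integer $d \ge 1$ and a real number $X > 0$ put $$\mathcal{A}_d(X) = \{x \in \mathbb{Z} : 1 \le x \le X,\ d \mid \gcd(x, \lfloor P(x) \rfloor)\}.$$ Then there are constants $\mu, C_0 > 0$, depending only on $P$, such that for all integers $d \ge 1$ and all real $X > 0$ $$\left|\,\#\mathcal{A}_d(X) - \frac{X}{d^2}\right| \le C_0 \left(\frac{X}{d}\right)^{1-\mu}.$$ -/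

import Mathlib

/-- A real number `α` is Liouville in the sense used here: for every `n` there are integers `p`
and `q > 1` with `|α - p / q| ≤ q ^ (-n)`. The case `α = p / q` is allowed, so that every rational
number counts as Liouville (in contrast to Mathlib's `Liouville`). -/
def IsLiouvilleNumber (α : ℝ) : Prop :=
  ∀ n : ℕ, ∃ p q : ℤ, 1 < q ∧ |α - (p : ℝ) / (q : ℝ)| ≤ (q : ℝ) ^ (-(n : ℤ))

/-- The set of positive integers `x ≤ X` such that `d` divides `gcd (x, ⌊P(x)⌋)`. -/
noncomputable def divGcdSet (P : Polynomial ℝ) (d : ℕ) (X : ℝ) : Finset ℕ :=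
  (Finset.Icc 1 ⌊X⌋₊).filter fun x => d ∣ Int.gcd (x : ℤ) ⌊P.eval (x : ℝ)⌋

theorem mem_divGcdSet {P : Polynomial ℝ} {d : ℕ} {X : ℝ} {x : ℕ} :
    x ∈ divGcdSet P d X ↔
      1 ≤ x ∧ (x : ℝ) ≤ X ∧ d ∣ Int.gcd (x : ℤ) ⌊P.eval (x : ℝ)⌋ := by
  unfold divGcdSet
  rw [Finset.mem_filter, Finset.mem_Icc, and_assoc]
  refine and_congr_right fun h1 => ?_
  rw [Nat.le_floor_iff' (by omega)]

/-! Writing x = dm, the condition d ∣ ⌊P(x)⌋ says that the fractional part of R(m) = P(dm)/d is less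
than 1/d. All coefficients of R except that of x may vary with d, but the linear one is that of P.
It thus suffices to equidistribute R(m) modulo 1 with a power saving that is uniform over all
polynomials of bounded degree with a fixed non-Liouville linear coefficient.

The engine is an inverse theorem for Weyl sums. Differencing and induction on the degree
(`weylInverse_top`) show that a large sum makes the top coefficient nearly p/q with q small. The
phase of that term is then a function of period q times a factor of bounded variation; removing both
lowers the degree and only shifts the linear coefficient by a multiple of 1/q
(`exists_lower_degree_large_weylSum`). Iterating, a large sum puts the linear coefficient near a
rational of small denominator (`weylInverse_linear`), which a non-Liouville number forbids
(`exists_pow_weylSum_lt`).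

To return to counting, the indicator of {y} < c is c plus a difference of two sawtooth values. The
square of the sawtooth has an absolutely convergent Fourier series, so its averages follow from Weyl
sums without truncation; a small translation of the argument then yields the sawtooth itself
(`exists_abs_sum_sawtooth_le_div`). -/

open Finset

/-! ### Additive characters and geometric sums -/

/-- The additive character `x ↦ exp (2πix)` of `ℝ`. -/
noncomputable def expPhase (x : ℝ) : ℂ := Complex.exp (Complex.I * ((2 * Real.pi * x : ℝ) : ℂ))

theorem expPhase_add (x y : ℝ) : expPhase (x + y) = expPhase x * expPhase y := by
  simp only [expPhase, ← Complex.exp_add]; push_cast; ring_nf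

theorem norm_expPhase (x : ℝ) : ‖expPhase x‖ = 1 := by
  rw [expPhase, mul_comm, Complex.norm_exp_ofReal_mul_I]

theorem expPhase_intCast (n : ℤ) : expPhase n = 1 := by
  rw [expPhase, Complex.exp_eq_one_iff]; exact ⟨n, by push_cast; ring⟩

theorem expPhase_neg (x : ℝ) : expPhase (-x) = (starRingEnd ℂ) (expPhase x) := by
  simp only [expPhase, ← Complex.exp_conj, map_mul, Complex.conj_I, Complex.conj_ofReal]
  push_cast; ring_nf

theorem expPhase_natCast_mul (n : ℕ) (x : ℝ) : expPhase (n * x) = expPhase x ^ n := by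
  simp only [expPhase, ← Complex.exp_nat_mul]; push_cast; ring_nf

theorem expPhase_sub_int (x : ℝ) (n : ℤ) : expPhase (x - n) = expPhase x := by
  have := expPhase_intCast (-n)
  rw [sub_eq_add_neg, expPhase_add, ← Int.cast_neg, this, mul_one]

theorem norm_expPhase_sub_one_le (x : ℝ) : ‖expPhase x - 1‖ ≤ 2 * Real.pi * |x| := by
  have h := Real.norm_exp_I_mul_ofReal_sub_one_le (x := 2 * Real.pi * x)
  rwa [Real.norm_eq_abs, abs_mul, abs_of_pos Real.two_pi_pos] at h

theorem norm_expPhase_sub_expPhase_le (x y : ℝ) :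
    ‖expPhase x - expPhase y‖ ≤ 2 * Real.pi * |x - y| := by
  have : expPhase x - expPhase y = (expPhase (x - y) - 1) * expPhase y := by
    rw [sub_mul, ← expPhase_add, sub_add_cancel, one_mul]
  rw [this, norm_mul, norm_expPhase, mul_one]
  exact norm_expPhase_sub_one_le _

/-- The norm on the right is 2|sin πx|, and Jordan's inequality bounds the sine below on [-π/2,
π/2]. -/
theorem four_mul_abs_sub_round_le (x : ℝ) : 4 * |x - round x| ≤ ‖expPhase x - 1‖ := by
  rw [← expPhase_sub_int x (round x)]
  set y := x - round x with hy
  have hy2 : |y| ≤ 1 / 2 := abs_sub_round x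
  rw [expPhase, Complex.norm_exp_I_mul_ofReal_sub_one, Real.norm_eq_abs, abs_mul,
    abs_of_pos (two_pos : (0 : ℝ) < 2)]
  have hpi := Real.pi_pos
  have h1 : |2 * Real.pi * y / 2| = Real.pi * |y| := by
    rw [show 2 * Real.pi * y / 2 = Real.pi * y by ring, abs_mul, abs_of_pos hpi]
  have h2 := Real.mul_abs_le_abs_sin (x := 2 * Real.pi * y / 2) (by rw [h1]; nlinarith)
  rw [h1] at h2
  have : 2 / Real.pi * (Real.pi * |y|) = 2 * |y| := by field_simp
  linarith

/-- A geometric sum of phases is bounded by the inverse distance to the nearest integer. -/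
theorem norm_sum_expPhase_linear (a c : ℝ) (N : ℕ) :
    ‖∑ n ∈ range N, expPhase (a * n + c)‖ * |a - round a| ≤ 1 := by
  have h1 : ∑ n ∈ range N, expPhase (a * n + c) = (∑ n ∈ range N, expPhase a ^ n) * expPhase c := by
    rw [sum_mul]
    refine sum_congr rfl fun n _ => ?_
    rw [expPhase_add, mul_comm a, expPhase_natCast_mul]
  have h2 := geom_sum_mul (expPhase a) N
  have h3 : ‖∑ n ∈ range N, expPhase a ^ n‖ * ‖expPhase a - 1‖ ≤ 2 := by
    rw [← norm_mul, h2]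
    refine (norm_sub_le _ _).trans ?_
    rw [norm_pow, norm_expPhase]; norm_num
  have h4 := four_mul_abs_sub_round_le a
  rw [h1, norm_mul, norm_expPhase, mul_one]
  nlinarith [norm_nonneg (∑ n ∈ range N, expPhase a ^ n)]

/-! ### Van der Corput's inequality, summation by parts, periodic weights -/

/-- The sum of the autocorrelations of `z` at the shifts `0 ≤ h < N`. -/
theorem normSq_sum_range_eq (z : ℕ → ℂ) (N : ℕ) :
    ‖∑ n ∈ range N, z n‖ ^ 2 + ∑ n ∈ range N, ‖z n‖ ^ 2 =
      2 * (∑ h ∈ range N, ∑ n ∈ range (N - h), z (n + h) * (starRingEnd ℂ) (z n)).re := by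
  induction N with
  | zero => simp
  | succ N ih =>
    -- Lengthening the range by one adds, for each shift h, the single product of z N with the
    -- conjugate of z (N - h).
    have key : ∑ h ∈ range (N + 1), ∑ n ∈ range (N + 1 - h), z (n + h) * (starRingEnd ℂ) (z n) =
        (∑ h ∈ range N, ∑ n ∈ range (N - h), z (n + h) * (starRingEnd ℂ) (z n)) +
          z N * (starRingEnd ℂ) (∑ n ∈ range (N + 1), z n) := by
      have h1 : ∑ h ∈ range (N + 1), ∑ n ∈ range (N + 1 - h), z (n + h) * (starRingEnd ℂ) (z n) =
          ∑ h ∈ range (N + 1), ((∑ n ∈ range (N - h), z (n + h) * (starRingEnd ℂ) (z n)) +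
            z N * (starRingEnd ℂ) (z (N - h))) := by
        refine sum_congr rfl fun h hh => ?_
        have : h ≤ N := by simpa [Nat.lt_succ_iff] using hh
        rw [Nat.succ_sub this, sum_range_succ, Nat.sub_add_cancel this]
      rw [h1, sum_add_distrib, sum_range_succ _ N, Nat.sub_self, range_zero, sum_empty, add_zero,
        ← mul_sum, map_sum]
      congr 2
      have := sum_range_reflect (fun n => (starRingEnd ℂ) (z n)) (N + 1)
      rw [← this]
      rfl
    rw [key, Complex.add_re, mul_add, ← ih, sum_range_succ z, sum_range_succ (fun n => ‖z n‖ ^ 2)]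
    simp only [← Complex.normSq_eq_norm_sq, Complex.normSq_apply, map_add, Complex.add_re,
      Complex.add_im, Complex.mul_re, Complex.conj_re, Complex.conj_im]
    ring

/-- Van der Corput's inequality with all shifts. -/
theorem norm_sum_range_sq_le (z : ℕ → ℂ) (N : ℕ) :
    ‖∑ n ∈ range N, z n‖ ^ 2 ≤
      2 * ∑ h ∈ range N, ‖∑ n ∈ range (N - h), z (n + h) * (starRingEnd ℂ) (z n)‖ := by
  have h1 := normSq_sum_range_eq z N
  have h2 : 0 ≤ ∑ n ∈ range N, ‖z n‖ ^ 2 := sum_nonneg fun _ _ => by positivity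
  have h3 := Complex.re_le_norm
    (∑ h ∈ range N, ∑ n ∈ range (N - h), z (n + h) * (starRingEnd ℂ) (z n))
  have h4 := norm_sum_le (range N)
    (fun h => ∑ n ∈ range (N - h), z (n + h) * (starRingEnd ℂ) (z n))
  linarith

/-- Summation by parts: a weight of bounded variation does not enlarge partial sums by much. -/
theorem norm_sum_mul_le_of_variation (f w : ℕ → ℂ) (N : ℕ) {B V : ℝ}
    (hB : ∀ m ≤ N, ‖∑ n ∈ range m, f n‖ ≤ B) (hw : ∀ n, ‖w n‖ ≤ 1)
    (hV : ∑ n ∈ range N, ‖w (n + 1) - w n‖ ≤ V) :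
    ‖∑ n ∈ range N, w n * f n‖ ≤ B * (1 + V) := by
  have hB0 : 0 ≤ B := (norm_nonneg _).trans (hB 0 (Nat.zero_le _))
  have h := sum_range_by_parts w f N
  simp only [smul_eq_mul] at h
  rw [h]
  refine (norm_sub_le _ _).trans ?_
  have h1 : ‖w (N - 1) * ∑ i ∈ range N, f i‖ ≤ B := by
    rw [norm_mul]
    have := hB N le_rfl
    nlinarith [hw (N - 1), norm_nonneg (w (N - 1)), norm_nonneg (∑ i ∈ range N, f i)]
  have h2 : ‖∑ i ∈ range (N - 1), (w (i + 1) - w i) * ∑ i ∈ range (i + 1), f i‖ ≤ B * V := by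
    calc _ ≤ ∑ i ∈ range (N - 1), ‖w (i + 1) - w i‖ * B := by
          refine norm_sum_le_of_le _ fun i hi => ?_
          rw [norm_mul]
          refine mul_le_mul_of_nonneg_left (hB _ ?_) (norm_nonneg _)
          have := mem_range.1 hi
          omega
      _ ≤ ∑ i ∈ range N, ‖w (i + 1) - w i‖ * B :=
          sum_le_sum_of_subset_of_nonneg (range_subset_range.2 (Nat.sub_le _ _))
            fun _ _ _ => by positivity
      _ ≤ _ := by rw [← sum_mul, mul_comm]; exact mul_le_mul_of_nonneg_left hV hB0
  linarith

/-- The phase is Lipschitz and n ^ k is monotone, so the variation telescopes. -/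
theorem sum_norm_expPhase_monomial_variation_le (γ : ℝ) (k N : ℕ) :
    ∑ n ∈ range N, ‖expPhase (γ * ((n + 1 : ℕ) : ℝ) ^ k) - expPhase (γ * (n : ℝ) ^ k)‖ ≤
      2 * Real.pi * |γ| * (N : ℝ) ^ k := by
  calc _ ≤ ∑ n ∈ range N, 2 * Real.pi * |γ| * (((n + 1 : ℕ) : ℝ) ^ k - (n : ℝ) ^ k) := by
        refine sum_le_sum fun n _ => (norm_expPhase_sub_expPhase_le _ _).trans_eq ?_
        have : (0 : ℝ) ≤ ((n + 1 : ℕ) : ℝ) ^ k - (n : ℝ) ^ k :=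
          sub_nonneg.2 (pow_le_pow_left₀ (by positivity) (by push_cast; linarith) k)
        rw [← mul_sub, abs_mul, abs_of_nonneg this, mul_assoc _ |γ|]
    _ ≤ _ := by
        rw [← mul_sum, sum_range_sub (fun n : ℕ => (n : ℝ) ^ k)]
        have := Real.pi_pos
        refine mul_le_mul_of_nonneg_left ?_ (by positivity)
        have : (0 : ℝ) ≤ ((0 : ℕ) : ℝ) ^ k := by positivity
        linarith

/-- Orthogonality of the additive characters modulo `q`. -/
theorem sum_expPhase_div (q : ℕ) (hq : 0 < q) (m : ℤ) :
    ∑ b ∈ range q, expPhase (b * (m / q : ℝ)) = if (q : ℤ) ∣ m then (q : ℂ) else 0 := by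
  have hq' : (q : ℝ) ≠ 0 := by positivity
  simp only [expPhase_natCast_mul]
  split_ifs with h
  · obtain ⟨t, rfl⟩ := h
    have : ((((q : ℤ) * t : ℤ) : ℝ) / q) = (t : ℤ) := by push_cast; field_simp
    rw [this, expPhase_intCast]
    simp
  · have h1 := geom_sum_mul (expPhase (m / q : ℝ)) q
    rw [← expPhase_natCast_mul, mul_div_cancel₀ _ hq', expPhase_intCast, sub_self] at h1
    refine (mul_eq_zero.1 h1).resolve_right fun h2 => h ?_
    rw [sub_eq_zero, expPhase, Complex.exp_eq_one_iff] at h2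
    obtain ⟨n, hn⟩ := h2
    have h3 : (Complex.I * ((2 * Real.pi * (m / q) : ℝ) : ℂ)).im = (n * (2 * Real.pi * Complex.I)).im := by
      rw [hn]
    simp at h3
    have h4 : (m : ℝ) / q = n := by
      have := Real.pi_pos
      have h5 : 2 * Real.pi * ((m : ℝ) / q - n) = 0 := by linarith
      have := (mul_eq_zero.1 h5).resolve_left (by positivity)
      linarith
    rw [div_eq_iff hq'] at h4
    exact ⟨n, by rw [mul_comm]; exact_mod_cast h4⟩

/-- A weight of period `q` can be exchanged for a linear phase with denominator `q`. -/
theorem exists_norm_sum_periodic_le (f g : ℕ → ℂ) (q N : ℕ) (hq : 0 < q)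
    (hg : ∀ n, g (n % q) = g n) (hg1 : ∀ n, ‖g n‖ ≤ 1) :
    ∃ b : ℕ, ‖∑ n ∈ range N, g n * f n‖ ≤
      q * ‖∑ n ∈ range N, f n * expPhase (b * ((n : ℝ) / q))‖ := by
  have hq' : (q : ℂ) ≠ 0 := by exact_mod_cast hq.ne'
  -- Fourier inversion on the integers modulo q. Bounding its q² terms by the largest sum and
  -- cancelling the factor q leaves a loss of q.
  have hexp : ∀ n : ℕ, (q : ℂ) * g n = ∑ b ∈ range q, ∑ r ∈ range q,
      g r * expPhase (-(b * ((r : ℝ) / q))) * expPhase (b * ((n : ℝ) / q)) := by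
    intro n
    rw [sum_comm]
    have : ∀ r ∈ range q, ∑ b ∈ range q,
        g r * expPhase (-(b * ((r : ℝ) / q))) * expPhase (b * ((n : ℝ) / q)) =
        if n % q = r then (q : ℂ) * g n else 0 := by
      intro r hr
      have h1 : ∀ b ∈ range q,
          g r * expPhase (-(b * ((r : ℝ) / q))) * expPhase (b * ((n : ℝ) / q)) =
          g r * expPhase (b * ((((n : ℤ) - r : ℤ) : ℝ) / q)) := by
        intro b _
        rw [mul_assoc, ← expPhase_add]
        congr 2
        push_cast
        ring
      rw [sum_congr rfl h1, ← mul_sum, sum_expPhase_div q hq]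
      have h2 : ((q : ℤ) ∣ (n : ℤ) - r) ↔ n % q = r := by
        have := mem_range.1 hr
        have h3 := (Nat.modEq_iff_dvd (n := q) (a := r) (b := n)).symm
        rw [h3, Nat.ModEq, Nat.mod_eq_of_lt this, eq_comm]
      simp only [h2]
      split_ifs with h
      · rw [← hg n, h, mul_comm]
      · simp
    rw [sum_congr rfl this]
    simp [Nat.mod_lt _ hq]
  obtain ⟨b, -, hb⟩ := exists_max_image (range q)
    (fun b : ℕ => ‖∑ n ∈ range N, f n * expPhase (b * ((n : ℝ) / q))‖) ⟨0, by simpa⟩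
  refine ⟨b, ?_⟩
  set M := ‖∑ n ∈ range N, f n * expPhase (b * ((n : ℝ) / q))‖
  have h1 : (q : ℂ) * ∑ n ∈ range N, g n * f n = ∑ b ∈ range q, ∑ r ∈ range q,
      g r * expPhase (-(b * ((r : ℝ) / q))) *
        ∑ n ∈ range N, f n * expPhase (b * ((n : ℝ) / q)) := by
    have : (q : ℂ) * ∑ n ∈ range N, g n * f n = ∑ n ∈ range N, ∑ b ∈ range q, ∑ r ∈ range q,
      g r * expPhase (-(b * ((r : ℝ) / q))) * (f n * expPhase (b * ((n : ℝ) / q))) := by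
      rw [mul_sum]
      refine sum_congr rfl fun n _ => ?_
      rw [← mul_assoc, hexp, sum_mul]
      refine sum_congr rfl fun b _ => ?_
      rw [sum_mul]
      exact sum_congr rfl fun r _ => by ring
    rw [this, sum_comm]
    refine sum_congr rfl fun b _ => ?_
    rw [sum_comm]
    exact sum_congr rfl fun r _ => (mul_sum ..).symm
  have h2 : (q : ℝ) * ‖∑ n ∈ range N, g n * f n‖ ≤ q * (q * M) := by
    have h3 : ‖(q : ℂ) * ∑ n ∈ range N, g n * f n‖ = q * ‖∑ n ∈ range N, g n * f n‖ := by
      rw [norm_mul, Complex.norm_natCast]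
    rw [← h3, h1]
    calc _ ≤ ∑ b ∈ range q, ∑ r ∈ range q, M := by
          refine norm_sum_le_of_le _ fun c hc => norm_sum_le_of_le _ fun r _ => ?_
          rw [norm_mul, norm_mul, norm_expPhase, mul_one]
          calc _ ≤ 1 * M := mul_le_mul (hg1 r) (hb c hc) (norm_nonneg _) zero_le_one
            _ = M := one_mul M
      _ = _ := by simp
  exact le_of_mul_le_mul_left h2 (by exact_mod_cast hq)

/-! ### Diophantine approximation from many near-integer multiples -/

/-- Dirichlet approximation: the multiples `D * β`, `|D| ≤ N`, of `β` are separated modulo `1`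
except for the multiples of one denominator. -/
theorem exists_denominator_dvd_of_near_integer (β : ℝ) (N : ℕ) (hN : 0 < N) :
    ∃ (q : ℕ) (a : ℤ), 0 < q ∧ (q : ℝ) ≤ 2 * N ∧ |q * β - a| * (2 * N + 1) ≤ 1 ∧
      ∀ D s : ℤ, |(D : ℝ)| ≤ N → |D * β - s| * (2 * q) < 1 → (q : ℤ) ∣ D := by
  obtain ⟨r, hr, hden⟩ := Real.exists_rat_abs_sub_le_and_den_le β (n := 2 * N) (by omega)
  have hq0 : (0 : ℝ) < r.den := by exact_mod_cast r.den_pos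
  have hcop : IsCoprime r.num (r.den : ℤ) := by
    rw [Int.isCoprime_iff_gcd_eq_one]; exact r.reduced
  have hθle : |r.den * β - r.num| * (2 * N + 1) ≤ 1 := by
    have h1 : r.den * β - r.num = r.den * (β - r) := by rw [Rat.cast_def]; field_simp
    rw [h1, abs_mul, abs_of_pos hq0]
    rw [le_div_iff₀ (by positivity)] at hr
    push_cast at hr
    linarith
  refine ⟨r.den, r.num, r.den_pos, by exact_mod_cast hden, hθle, fun D s hD hs => ?_⟩
  -- An integer of absolute value below 1: the first term is below 1/2 by hypothesis, the second at
  -- most 1/2 because the approximation has order 2N rather than N.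
  have h1 : ((D * r.num - s * r.den : ℤ) : ℝ) =
      r.den * (D * β - s) - D * (r.den * β - r.num) := by
    push_cast; ring
  have h2 : |((D * r.num - s * r.den : ℤ) : ℝ)| < 1 := by
    rw [h1]
    refine (abs_sub _ _).trans_lt ?_
    rw [abs_mul, abs_mul, abs_of_pos hq0]
    have : |(D : ℝ)| * |r.den * β - r.num| ≤ N * |r.den * β - r.num| := by gcongr
    have := abs_nonneg (r.den * β - r.num)
    linarith
  have h3 : D * r.num - s * r.den = 0 := by
    rw [← Int.abs_lt_one_iff]
    exact_mod_cast h2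
  have h4 : (r.den : ℤ) ∣ D * r.num := ⟨s, by linarith⟩
  exact hcop.symm.dvd_of_dvd_mul_right h4

theorem card_Icc_floor_le {x : ℝ} (hx : 0 ≤ x) : (#(Icc ⌊-x⌋ ⌊x⌋) : ℝ) ≤ 2 * x + 2 := by
  have h6 : ⌊-x⌋ ≤ ⌊x⌋ := Int.floor_le_floor (by linarith)
  have h4 : 0 ≤ ⌊x⌋ + 1 - ⌊-x⌋ := by linarith
  have h5 : ((⌊x⌋ + 1 - ⌊-x⌋).toNat : ℝ) = ((⌊x⌋ + 1 - ⌊-x⌋ : ℤ) : ℝ) := by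
    exact_mod_cast congrArg (Int.cast (R := ℝ)) (Int.toNat_of_nonneg h4)
  rw [Int.card_Icc, h5]
  push_cast
  have h7 := Int.floor_le x
  have h8 := Int.lt_floor_add_one (-x)
  linarith

/-- Sort h by its block of length q and by the signed distance of hβ to an integer, in cells of
width 1/(2q). Two members of one cell differ by a multiple of q inside one block, so they coincide.
-/
theorem card_near_integers_le {β ε : ℝ} {N q : ℕ} {H : Finset ℕ} (hH : H ⊆ range N) (hε0 : 0 ≤ ε)
    (hq : 0 < q) (hnear : ∀ h ∈ H, |h * β - round (h * β)| ≤ ε)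
    (hdiv : ∀ D s : ℤ, |(D : ℝ)| ≤ N → |D * β - s| * (2 * q) < 1 → (q : ℤ) ∣ D) :
    (#H : ℝ) ≤ (N / q + 1) * (4 * q * ε + 2) := by
  have hq0 : (0 : ℝ) < q := by exact_mod_cast hq
  have hinj : #H ≤ #(range (N / q + 1) ×ˢ Icc (⌊-(2 * q * ε)⌋) (⌊2 * q * ε⌋)) := by
    refine card_le_card_of_injOn
      (fun h => (h / q, ⌊2 * q * (h * β - round (h * β))⌋)) ?_ ?_
    · intro h hh
      have h1 := abs_le.1 (hnear h hh)
      have h2 := mem_range.1 (hH hh)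
      simp only [coe_product, Set.mem_prod, mem_coe, mem_range, mem_Icc]
      refine ⟨Nat.lt_succ_of_le (Nat.div_le_div_right h2.le), Int.floor_le_floor ?_,
        Int.floor_le_floor ?_⟩
      · rw [← mul_neg]
        exact mul_le_mul_of_nonneg_left h1.1 (by positivity)
      · exact mul_le_mul_of_nonneg_left h1.2 (by positivity)
    · intro x hx y hy hxy
      simp only [Prod.mk.injEq] at hxy
      obtain ⟨hxy1, hxy2⟩ := hxy
      have hxN := mem_range.1 (hH hx)
      have hyN := mem_range.1 (hH hy)
      have h1 := Int.abs_sub_lt_one_of_floor_eq_floor hxy2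
      have h2 : (q : ℤ) ∣ (x : ℤ) - y := by
        refine hdiv _ (round (x * β) - round (y * β)) ?_ ?_
        · push_cast
          rw [abs_le]
          have : (x : ℝ) ≤ N := by exact_mod_cast hxN.le
          have : (y : ℝ) ≤ N := by exact_mod_cast hyN.le
          constructor <;> linarith [Nat.cast_nonneg (α := ℝ) x, Nat.cast_nonneg (α := ℝ) y]
        · rw [← mul_sub, abs_mul, abs_of_pos (by positivity)] at h1
          push_cast
          rw [mul_comm]
          have h3 : ((x : ℝ) - y) * β - (round (x * β) - round (y * β)) =
              x * β - round (x * β) - (y * β - round (y * β)) := by ring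
          rwa [h3]
      have h3 := Nat.div_add_mod x q
      have h4 := Nat.div_add_mod y q
      have h5 : x % q = y % q := ((Nat.modEq_iff_dvd (n := q) (a := y) (b := x)).2 h2).symm
      rw [← h3, ← h4, hxy1, h5]
  rw [card_product, card_range] at hinj
  have h1 : (#H : ℝ) ≤ ((N / q + 1 : ℕ) : ℝ) * (#(Icc (⌊-(2 * q * ε)⌋) (⌊2 * q * ε⌋)) : ℝ) := by
    exact_mod_cast hinj
  have h2 : ((N / q + 1 : ℕ) : ℝ) ≤ N / q + 1 := by
    push_cast
    gcongr
    exact Nat.cast_div_le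
  have h3 := card_Icc_floor_le (x := 2 * q * ε) (by positivity)
  refine h1.trans (mul_le_mul h2 (h3.trans_eq (by ring)) (by positivity) (by positivity))

/-- For h = qt the number hβ is an integer plus t(qβ - a). This error is below 1/2, so it is the
exact distance to the nearest integer. -/
theorem mul_abs_le_of_dvd_of_near_integer {β ε : ℝ} {N q h : ℕ} {a : ℤ} (hq : 0 < q) (hhN : h ≤ N)
    (hθle : |q * β - a| * (2 * N + 1) ≤ 1) (hdvd : q ∣ h)
    (hnear : |h * β - round (h * β)| ≤ ε) : h * |q * β - a| ≤ ε * q := by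
  obtain ⟨t, ht⟩ := hdvd
  set θ := q * β - a with hθ
  have hq1 : (1 : ℝ) ≤ q := by exact_mod_cast hq
  have hht : (h : ℝ) = q * t := by rw [ht]; push_cast; ring
  have h1 : h * β = (t * a : ℤ) + t * θ := by rw [hθ, hht]; push_cast; ring
  have htN : (t : ℝ) ≤ N := by
    have h2 : t ≤ h := by rw [ht]; exact Nat.le_mul_of_pos_left _ hq
    exact_mod_cast h2.trans hhN
  have h2 : |t * θ| < 1 / 2 := by
    rw [abs_mul, Nat.abs_cast]
    have h5 : t * |θ| ≤ N * |θ| := by gcongr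
    rcases (abs_nonneg θ).eq_or_lt with h0 | h0
    · rw [← h0]; norm_num
    · linarith
  have h4 : round (t * θ) = 0 := by
    rw [round_eq_zero_iff]
    have := abs_lt.1 h2
    constructor <;> linarith
  rw [h1, round_intCast_add, h4, add_zero, add_sub_cancel_left, abs_mul, Nat.abs_cast] at hnear
  rw [hht]
  calc (q : ℝ) * t * |θ| = (t * |θ|) * q := by ring
    _ ≤ ε * q := by gcongr

/-- If many `h < N` have `h * β` very close to an integer, then `β` is very close to a rational
number with small denominator. -/
theorem exists_denominator_of_many_near_integers (β : ℝ) (N : ℕ) (H : Finset ℕ)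
    (hH : H ⊆ range N) {η ε : ℝ} (hcard : η * N ≤ (#H : ℝ)) (hηN : 2 ≤ η * N)
    (hε0 : 0 ≤ ε) (hε : 24 * ε < η) (hnear : ∀ h ∈ H, |h * β - round (h * β)| ≤ ε) :
    ∃ q : ℕ, 0 < q ∧ q * η ≤ 12 ∧ ∃ p : ℤ, |q * β - p| * (η * N) ≤ 2 * ε * q := by
  have hHN : (#H : ℝ) ≤ N := by
    have := card_le_card hH
    rw [card_range] at this
    exact_mod_cast this
  have hN : (2 : ℝ) ≤ N := by linarith
  have hNpos : 0 < N := by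
    have : (0 : ℝ) < N := by linarith
    exact_mod_cast this
  obtain ⟨q, a, hqpos, hdenR, hθle, hdiv⟩ := exists_denominator_dvd_of_near_integer β N hNpos
  have hq0 : (0 : ℝ) < q := by exact_mod_cast hqpos
  -- Since q ≤ 2N, the count gives qη ≤ 12qε + 6, and 24ε < η absorbs the first term into half of
  -- the left side.
  have hqη : q * η ≤ 12 := by
    have h1 : (N : ℝ) / q + 1 ≤ 3 * N / q := by
      rw [← sub_nonneg]
      have : 3 * (N : ℝ) / q - (N / q + 1) = (2 * N - q) / q := by field_simp; ring
      rw [this]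
      exact div_nonneg (by linarith) hq0.le
    have h2 : η * N ≤ 3 * N / q * (4 * q * ε + 2) :=
      (hcard.trans (card_near_integers_le hH hε0 hqpos hnear hdiv)).trans (by gcongr)
    have h4 : N * (q * η) ≤ N * (12 * q * ε + 6) := by
      calc N * (q * η) = η * N * q := by ring
        _ ≤ 3 * N / q * (4 * q * ε + 2) * q := by gcongr
        _ = N * (12 * q * ε + 6) := by field_simp; ring
    have h5 := le_of_mul_le_mul_left h4 (by linarith)
    have h6 : q * (24 * ε) ≤ q * η := by gcongr
    linarith
  refine ⟨q, hqpos, hqη, a, ?_⟩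
  have hεq : ε * (2 * q) < 1 := by
    have h6 : q * (24 * ε) < q * η := by gcongr
    linarith
  have hbound : ∀ h ∈ H, h * |q * β - a| ≤ ε * q := by
    intro h hh
    have hhN : h ≤ N := (mem_range.1 (hH hh)).le
    have h1 := hdiv h (round (h * β)) (by simpa using hhN) (by
      push_cast
      exact lt_of_le_of_lt (by gcongr; exact hnear h hh) hεq)
    exact mul_abs_le_of_dvd_of_near_integer hqpos hhN hθle (by exact_mod_cast h1) (hnear h hh)
  -- Some element of H is at least #H - 1, which is at least ηN/2 because ηN ≥ 2; a large h gives
  -- the strongest bound on |qβ - a|.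
  have hlarge : ∃ h ∈ H, #H ≤ h + 1 := by
    by_contra! hcon
    have hsub : H ⊆ range (#H - 1) := fun h hh => mem_range.2 (by have := hcon h hh; omega)
    have h1 := card_le_card hsub
    rw [card_range] at h1
    have h2 : (0 : ℝ) < #H := by linarith
    have h3 : 0 < #H := by exact_mod_cast h2
    omega
  obtain ⟨h, hh, hh1⟩ := hlarge
  have hh2 : (#H : ℝ) ≤ h + 1 := by exact_mod_cast hh1
  have h3 : η * N ≤ 2 * h := by linarith
  calc |q * β - a| * (η * N) ≤ |q * β - a| * (2 * h) := by gcongr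
    _ = 2 * (h * |q * β - a|) := by ring
    _ ≤ 2 * (ε * q) := mul_le_mul_of_nonneg_left (hbound h hh) zero_le_two
    _ = 2 * ε * q := by ring

/-! ### Weyl differencing and the top coefficient -/

/-- The exponential sum `∑_{n < N} e(Q(n))`. -/
noncomputable def weylSum (Q : Polynomial ℝ) (N : ℕ) : ℂ :=
  ∑ n ∈ range N, expPhase (Q.eval (n : ℝ))

theorem norm_weylSum_le (Q : Polynomial ℝ) (N : ℕ) : ‖weylSum Q N‖ ≤ N := by
  refine (norm_sum_le _ _).trans ?_
  simp [norm_expPhase]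

open Polynomial in
theorem natDegree_taylor_sub_le {k : ℕ} {Q : ℝ[X]} (hQ : Q.natDegree ≤ k + 1) (h : ℝ) :
    (taylor h Q - Q).natDegree ≤ k := by
  rw [natDegree_le_iff_coeff_eq_zero]
  intro n hn
  rw [coeff_sub, sub_eq_zero]
  rcases Nat.lt_or_ge Q.natDegree n with h1 | h1
  · rw [coeff_eq_zero_of_natDegree_lt h1, coeff_eq_zero_of_natDegree_lt]
    rwa [natDegree_taylor]
  · have h2 : n = Q.natDegree := by omega
    rw [h2, coeff_natDegree]
    rw [← leadingCoeff_taylor h Q, leadingCoeff, natDegree_taylor]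

open Polynomial in
theorem coeff_taylor_sub {k : ℕ} {Q : ℝ[X]} (hQ : Q.natDegree ≤ k + 1) (h : ℝ) :
    (taylor h Q - Q).coeff k = (k + 1) * h * Q.coeff (k + 1) := by
  have h1 : (hasseDeriv k Q).natDegree < 2 := by
    have := natDegree_hasseDeriv_le Q k
    omega
  rw [coeff_sub, taylor_coeff, eval_eq_sum_range' h1]
  simp [Finset.sum_range_succ, hasseDeriv_coeff, add_comm 1 k]
  ring

theorem sum_expPhase_eval_shift_mul_conj (Q : Polynomial ℝ) (h N : ℕ) :
    ∑ n ∈ range N, expPhase (Q.eval ((n + h : ℕ) : ℝ)) *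
      (starRingEnd ℂ) (expPhase (Q.eval (n : ℝ))) =
      weylSum (Polynomial.taylor (h : ℝ) Q - Q) N := by
  refine sum_congr rfl fun n _ => ?_
  rw [← expPhase_neg, ← expPhase_add, Polynomial.eval_sub, Polynomial.taylor_eval, Nat.cast_add,
    sub_eq_add_neg]

/-- For polynomials of degree at most `k`, a large Weyl sum forces the `j`-th coefficient to be close
to a rational number with small denominator, at scale `N ^ j`; all losses are powers of `T`. -/
def WeylInverse (k j : ℕ) : Prop :=
  ∃ C : ℕ, ∀ (T : ℝ) (N : ℕ) (Q : Polynomial ℝ), 2 ≤ T → 1 ≤ N → Q.natDegree ≤ k →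
    N ≤ T * ‖weylSum Q N‖ →
    ∃ q : ℕ, 0 < q ∧ (q : ℝ) ≤ T ^ C ∧ ∃ p : ℤ, |q * Q.coeff j - p| * (N : ℝ) ^ j ≤ T ^ C

theorem weylInverse_one_one : WeylInverse 1 1 := by
  refine ⟨1, fun T N Q hT hN hQ hS => ⟨1, one_pos, by simp; linarith, round (Q.coeff 1), ?_⟩⟩
  have h1 : weylSum Q N = ∑ n ∈ range N, expPhase (Q.coeff 1 * n + Q.coeff 0) := by
    refine sum_congr rfl fun n _ => ?_
    rw [Polynomial.eval_eq_sum_range' (Nat.lt_succ_of_le hQ)]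
    simp [sum_range_succ, add_comm]
  have h2 := norm_sum_expPhase_linear (Q.coeff 1) (Q.coeff 0) N
  rw [← h1] at h2
  simp only [Nat.cast_one, one_mul, pow_one]
  have h3 := abs_nonneg (Q.coeff 1 - round (Q.coeff 1))
  calc |Q.coeff 1 - round (Q.coeff 1)| * N
      ≤ |Q.coeff 1 - round (Q.coeff 1)| * (T * ‖weylSum Q N‖) := by gcongr
    _ = T * (‖weylSum Q N‖ * |Q.coeff 1 - round (Q.coeff 1)|) := by ring
    _ ≤ T * 1 := by gcongr
    _ = T := mul_one T

/-- A large Weyl sum has many large differenced sums. -/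
theorem card_large_differences_ge {T : ℝ} {N : ℕ} {Q : Polynomial ℝ} (hT : 2 ≤ T) (hN : 1 ≤ N)
    (hS : N ≤ T * ‖weylSum Q N‖) :
    (N : ℝ) ≤ 4 * T ^ 2 * #{h ∈ range N | (N : ℝ) ≤
      4 * T ^ 2 * ‖weylSum (Polynomial.taylor ((h : ℕ) : ℝ) Q - Q) (N - h)‖} := by
  set U := 4 * T ^ 2 with hU
  have hU0 : 0 < U := by positivity
  have hN0 : (0 : ℝ) < N := by exact_mod_cast hN
  set D : ℕ → ℝ := fun h => ‖weylSum (Polynomial.taylor (h : ℝ) Q - Q) (N - h)‖ with hD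
  have h1 : ‖weylSum Q N‖ ^ 2 ≤ 2 * ∑ h ∈ range N, D h := by
    have := norm_sum_range_sq_le (fun n => expPhase (Q.eval (n : ℝ))) N
    simp only [sum_expPhase_eval_shift_mul_conj] at this
    exact this
  -- The factor 4 in U makes the small differences contribute at most N²/2 after multiplication by
  -- 2T², which the left side absorbs.
  have h2 : ∑ h ∈ range N, D h ≤ #{h ∈ range N | (N : ℝ) ≤ U * D h} * N + N * (N / U) := by
    rw [← sum_filter_add_sum_filter_not (range N) (fun h => (N : ℝ) ≤ U * D h)]
    gcongr ?_ + ?_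
    · rw [← nsmul_eq_mul]
      refine sum_le_card_nsmul _ _ _ fun h _ => (norm_weylSum_le _ _).trans ?_
      exact_mod_cast Nat.sub_le _ _
    · calc _ ≤ #{h ∈ range N | ¬ (N : ℝ) ≤ U * D h} • ((N : ℝ) / U) := by
            refine sum_le_card_nsmul _ _ _ fun h hh => ?_
            rw [le_div_iff₀ hU0, mul_comm]
            exact (not_le.1 (mem_filter.1 hh).2).le
        _ ≤ N * (N / U) := by
            rw [nsmul_eq_mul]
            gcongr
            simpa using card_filter_le (range N) (fun h => ¬ (N : ℝ) ≤ U * D h)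
  have h3 : (N : ℝ) ^ 2 ≤ T ^ 2 * ‖weylSum Q N‖ ^ 2 := by
    rw [← mul_pow]; gcongr
  have h4 : (N : ℝ) ^ 2 ≤ T ^ 2 * (2 * (#{h ∈ range N | (N : ℝ) ≤ U * D h} * N + N * (N / U))) :=
    h3.trans (by gcongr; exact h1.trans (by gcongr))
  have h5 : T ^ 2 * (2 * (#{h ∈ range N | (N : ℝ) ≤ U * D h} * N + N * (N / U))) =
      (U * #{h ∈ range N | (N : ℝ) ≤ U * D h} * N + N ^ 2) / 2 := by
    have : T ≠ 0 := by positivity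
    rw [hU]; field_simp; ring
  rw [h5] at h4
  have h6 : N * (N : ℝ) ≤ (U * #{h ∈ range N | (N : ℝ) ≤ U * D h}) * N := by linarith
  exact le_of_mul_le_mul_right h6 hN0

/-- Each large differenced sum has degree at most k and k-th coefficient (k + 1)h times that of Q,
so the hypothesis applies to it. The denominators depend on h, but there are at most U ^ C of them,
and the pigeonhole principle fixes one. -/
theorem WeylInverse.many_differences {k : ℕ} (hk : WeylInverse k k) :
    ∃ C : ℕ, ∀ (T : ℝ) (N : ℕ) (Q : Polynomial ℝ), 2 ≤ T → 1 ≤ N → Q.natDegree ≤ k + 1 →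
      N ≤ T * ‖weylSum Q N‖ →
      ∃ q : ℕ, 0 < q ∧ (q : ℝ) ≤ (4 * T ^ 2) ^ C ∧ ∃ H ⊆ range N,
        (N : ℝ) ≤ (4 * T ^ 2) ^ (C + 1) * #H ∧ ∀ h ∈ H, ∃ p : ℤ,
          |h * (q * (k + 1) * Q.coeff (k + 1)) - p| * (N : ℝ) ^ k ≤ (4 * T ^ 2) ^ (C + k) := by
  obtain ⟨C, hC⟩ := hk
  refine ⟨C, fun T N Q hT hN hQ hS => ?_⟩
  have hcard := card_large_differences_ge hT hN hS
  set U := 4 * T ^ 2 with hU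
  have hU2 : 2 ≤ U := by nlinarith
  have hU0 : 0 < U := by linarith
  have hN0 : (0 : ℝ) < N := by exact_mod_cast hN
  set G := {h ∈ range N |
      (N : ℝ) ≤ U * ‖weylSum (Polynomial.taylor ((h : ℕ) : ℝ) Q - Q) (N - h)‖} with hG
  -- A large differenced sum cannot be short, so replacing its length N - h by N costs only a factor
  -- U per power.
  have hGN : ∀ h ∈ G, (N : ℝ) ≤ U * (N - h : ℕ) := fun h hh =>
    (mem_filter.1 hh).2.trans (by gcongr; exact norm_weylSum_le _ _)
  have hex : ∀ h : ℕ, ∃ q : ℕ, h ∈ G → 0 < q ∧ (q : ℝ) ≤ U ^ C ∧ ∃ p : ℤ,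
      |q * (Polynomial.taylor (h : ℝ) Q - Q).coeff k - p| * ((N - h : ℕ) : ℝ) ^ k ≤ U ^ C := by
    intro h
    by_cases hh : h ∈ G
    · have h1 : 1 ≤ N - h := by
        have := mem_range.1 (mem_filter.1 hh).1
        omega
      have h2 : ((N - h : ℕ) : ℝ) ≤ N := by exact_mod_cast Nat.sub_le _ _
      obtain ⟨q, hq⟩ := hC U (N - h) _ hU2 h1 (natDegree_taylor_sub_le hQ h)
        (h2.trans (mem_filter.1 hh).2)
      exact ⟨q, fun _ => hq⟩
    · exact ⟨0, fun h => absurd h hh⟩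
  choose r hr using hex
  have hUC : 1 ≤ U ^ C := one_le_pow₀ (by linarith)
  obtain ⟨q, hq, hqcard⟩ := exists_le_card_fiber_of_nsmul_le_card_of_maps_to
    (s := G) (t := Icc 1 ⌊U ^ C⌋₊) (f := r) (b := (N : ℝ) / U ^ (C + 1))
    (fun h hh => mem_Icc.2 ⟨(hr h hh).1, Nat.le_floor (hr h hh).2.1⟩)
    ⟨1, mem_Icc.2 ⟨le_rfl, Nat.le_floor (by simpa using hUC)⟩⟩ (by
      rw [nsmul_eq_mul, Nat.card_Icc, Nat.add_sub_cancel]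
      calc (⌊U ^ C⌋₊ : ℝ) * (N / U ^ (C + 1)) ≤ U ^ C * (N / U ^ (C + 1)) := by
            gcongr; exact Nat.floor_le (by positivity)
        _ = N / U := by rw [pow_succ]; field_simp
        _ ≤ #G := by rw [div_le_iff₀ hU0]; linarith)
  rw [mem_Icc] at hq
  refine ⟨q, hq.1, (Nat.le_floor_iff (by positivity)).1 hq.2, {h ∈ G | r h = q},
    (filter_subset _ _).trans (filter_subset _ _), ?_, fun h hh => ?_⟩
  · rw [div_le_iff₀ (by positivity)] at hqcard
    linarith
  · obtain ⟨hhG, rfl⟩ := mem_filter.1 hh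
    obtain ⟨-, -, p, hp⟩ := hr h hhG
    refine ⟨p, ?_⟩
    rw [coeff_taylor_sub hQ] at hp
    rw [show (h : ℝ) * (r h * (k + 1) * Q.coeff (k + 1)) =
      r h * ((k + 1) * h * Q.coeff (k + 1)) by ring]
    calc _ ≤ |r h * ((k + 1) * h * Q.coeff (k + 1)) - p| * (U * (N - h : ℕ)) ^ k := by
          gcongr; exact hGN h hhG
      _ = U ^ k * (|r h * ((k + 1) * h * Q.coeff (k + 1)) - p| * ((N - h : ℕ) : ℝ) ^ k) := by
          rw [mul_pow]; ring
      _ ≤ U ^ k * U ^ C := by gcongr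
      _ = U ^ (C + k) := by ring

/-- Differencing yields closeness only at scale N ^ k, but for many h at once;
`exists_denominator_of_many_near_integers` converts this abundance into the missing factor N. -/
theorem WeylInverse.succ_top {k : ℕ} (hk1 : 1 ≤ k) (hk : WeylInverse k k) :
    WeylInverse (k + 1) (k + 1) := by
  obtain ⟨C, hC⟩ := hk.many_differences
  set E := (2 * C + k + 3) * (k + 1) + (3 * C + 2 * k + 6) with hE
  refine ⟨4 * E, fun T N Q hT hN hQ hS => ?_⟩
  obtain ⟨q, hq0, hq, H, hH, hHcard, hnear⟩ := hC T N Q hT hN hQ hS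
  have hUT : 4 * T ^ 2 ≤ T ^ 4 := by
    calc 4 * T ^ 2 = 2 ^ 2 * T ^ 2 := by ring
      _ ≤ T ^ 2 * T ^ 2 := by gcongr
      _ = T ^ 4 := by ring
  set U := 4 * T ^ 2 with hU
  have hU16 : 16 ≤ U := by nlinarith
  have hU0 : 0 < U := by linarith
  have hU1 : 1 ≤ U := by linarith
  have hN1 : (1 : ℝ) ≤ N := by exact_mod_cast hN
  have hUE : U ^ E ≤ T ^ (4 * E) := by rw [pow_mul]; gcongr
  have hlift : ∀ m ≤ E, ∀ x : ℝ, x ≤ U ^ m → x ≤ T ^ (4 * E) := fun m hm x hx =>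
    hx.trans ((pow_le_pow_right₀ hU1 hm).trans hUE)
  set a := Q.coeff (k + 1) with ha
  -- The threshold is what 24ε < η requires for the η and ε below, using N ≤ N ^ k. Below it N is a
  -- power of U, so rounding with denominator 1 suffices.
  rcases le_or_gt (N : ℝ) (24 * U ^ (2 * C + k + 1)) with hsmall | hbig
  · refine ⟨1, one_pos, hlift 0 (Nat.zero_le _) _ (by simp), round a, ?_⟩
    refine hlift ((2 * C + k + 3) * (k + 1)) (by rw [hE]; omega) _ ?_
    have h1 : (N : ℝ) ≤ U ^ (2 * C + k + 3) := by
      refine hsmall.trans ?_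
      rw [show 2 * C + k + 3 = 2 + (2 * C + k + 1) by ring, pow_add U 2]
      gcongr
      nlinarith
    have h2 := abs_sub_round a
    calc _ ≤ 1 * (U ^ (2 * C + k + 3)) ^ (k + 1) := by
          rw [Nat.cast_one, one_mul]
          gcongr
          linarith
      _ = _ := by rw [one_mul, ← pow_mul]
  · have hNk : (N : ℝ) ≤ (N : ℝ) ^ k := le_self_pow₀ hN1 (by omega)
    have hNk0 : (0 : ℝ) < (N : ℝ) ^ k := by positivity
    obtain ⟨q₁, hq₁0, hq₁, p, hp⟩ := exists_denominator_of_many_near_integers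
      (q * (k + 1) * a) N H hH (η := 1 / U ^ (C + 1)) (ε := U ^ (C + k) / (N : ℝ) ^ k)
      (by rw [one_div_mul_eq_div, div_le_iff₀ (by positivity)]; linarith)
      (by
        rw [one_div_mul_eq_div, le_div_iff₀ (by positivity)]
        have : U ^ (C + 1) ≤ U ^ (2 * C + k + 1) := pow_le_pow_right₀ hU1 (by omega)
        have : 0 < U ^ (C + 1) := by positivity
        linarith)
      (by positivity)
      (by
        rw [mul_div_assoc', div_lt_div_iff₀ hNk0 (by positivity), mul_assoc, ← pow_add,
          show C + k + (C + 1) = 2 * C + k + 1 by ring]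
        linarith)
      (fun h hh => by
        obtain ⟨p, hp⟩ := hnear h hh
        rw [le_div_iff₀ hNk0]
        exact (mul_le_mul_of_nonneg_right (round_le _ p) hNk0.le).trans hp)
    have hq₁' : (q₁ : ℝ) ≤ 12 * U ^ (C + 1) := by
      rw [mul_one_div, div_le_iff₀ (by positivity)] at hq₁
      exact hq₁
    have hkU : ((k + 1 : ℕ) : ℝ) ≤ U ^ (k + 1) := by
      have h1 : ((k + 1 : ℕ) : ℝ) ≤ (2 : ℝ) ^ (k + 1) := by
        exact_mod_cast (Nat.lt_two_pow_self (n := k + 1)).le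
      exact h1.trans (by gcongr; linarith)
    refine ⟨q₁ * (q * (k + 1)), by positivity, hlift (1 + (C + 1) + (C + (k + 1))) ?_ _ ?_, p,
      hlift (2 + (C + k) + 2 * (C + 1)) ?_ _ ?_⟩
    · rw [hE]; nlinarith
    · push_cast
      push_cast at hkU
      rw [pow_add U (1 + (C + 1)), pow_add U 1, pow_add U C (k + 1), pow_one]
      gcongr
      exact hq₁'.trans (by gcongr; linarith)
    · rw [hE]; nlinarith
    · have h1 : ((q₁ * (q * (k + 1)) : ℕ) : ℝ) * a - p = q₁ * (q * (k + 1) * a) - p := by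
        push_cast; ring
      rw [h1]
      have h2 : |q₁ * (q * (k + 1) * a) - p| * (N : ℝ) ^ (k + 1) =
          |q₁ * (q * (k + 1) * a) - p| * (1 / U ^ (C + 1) * N) * (U ^ (C + 1) * N ^ k) := by
        field_simp
        ring
      rw [h2]
      calc _ ≤ 2 * (U ^ (C + k) / (N : ℝ) ^ k) * (12 * U ^ (C + 1)) * (U ^ (C + 1) * N ^ k) := by
            refine mul_le_mul_of_nonneg_right ?_ (by positivity)
            exact hp.trans (by gcongr)
        _ = 24 * (U ^ (C + k) * U ^ (2 * (C + 1))) := by field_simp; ring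
        _ ≤ U ^ 2 * (U ^ (C + k) * U ^ (2 * (C + 1))) := by gcongr; nlinarith
        _ = _ := by ring

theorem weylInverse_top (k : ℕ) (hk : 1 ≤ k) : WeylInverse k k := by
  induction k, hk using Nat.le_induction with
  | base => exact weylInverse_one_one
  | succ k hk ih => exact ih.succ_top hk

/-! ### From the top coefficient to the linear coefficient -/

open Polynomial in
/-- If the top coefficient is close to a rational number `p / q`, the corresponding phase can be
removed at the cost of shifting the linear coefficient by a multiple of `1 / q`. -/
theorem exists_lower_degree_large_weylSum {k : ℕ} {T A : ℝ} {N q : ℕ} {p : ℤ}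
    {Q : ℝ[X]} (hA : 1 ≤ A) (hq0 : 0 < q) (hqA : (q : ℝ) ≤ A)
    (hp : |q * Q.coeff k - p| * (N : ℝ) ^ k ≤ A) (hT : 0 < T)
    (hS : N ≤ T * ‖weylSum Q N‖) :
    ∃ (b m : ℕ), m ≤ N ∧
      N ≤ 8 * T * A ^ 2 * ‖weylSum (Q - monomial k (Q.coeff k) + monomial 1 ((b : ℝ) / q)) m‖ := by
  have hqR : (1 : ℝ) ≤ q := by exact_mod_cast hq0
  set a := Q.coeff k with ha
  -- The top coefficient splits as p/q + γ: the first part gives the periodic weight g, the second a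
  -- phase of variation O(A).
  set γ := (q * a - p) / q with hγ
  have hγN : |γ| * (N : ℝ) ^ k ≤ A := by
    rw [hγ, abs_div, Nat.abs_cast]
    refine le_trans ?_ hp
    gcongr
    exact div_le_self (abs_nonneg _) hqR
  set f : ℕ → ℂ := fun n =>
    expPhase (γ * (n : ℝ) ^ k) * expPhase ((Q - monomial k a).eval (n : ℝ)) with hf
  set g : ℕ → ℂ := fun n => expPhase (p * (n : ℝ) ^ k / q) with hg
  have hper : ∀ n, g (n % q) = g n := by
    intro n
    have h1 : (q : ℤ) ∣ ((n : ℤ) ^ k - ((n % q : ℕ) : ℤ) ^ k) := by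
      refine dvd_trans ?_ (sub_dvd_pow_sub_pow _ _ k)
      exact (Nat.modEq_iff_dvd (n := q)).1 (Nat.mod_modEq n q)
    obtain ⟨t, ht⟩ := h1
    have h2 : ((n : ℝ) ^ k - ((n % q : ℕ) : ℝ) ^ k) = q * t := by exact_mod_cast ht
    have h3 : p * (((n % q : ℕ) : ℝ)) ^ k / q = p * (n : ℝ) ^ k / q - (p * t : ℤ) := by
      have h4 : ((n % q : ℕ) : ℝ) ^ k = (n : ℝ) ^ k - q * t := by linarith
      rw [h4]
      push_cast
      field_simp
    simp only [hg, h3, expPhase_sub_int]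
  obtain ⟨b, hb⟩ := exists_norm_sum_periodic_le f g q N hq0 hper (fun n => (norm_expPhase _).le)
  set R := Q - monomial k a + monomial 1 ((b : ℝ) / q) with hR
  have h1 : weylSum Q N = ∑ n ∈ range N, g n * f n := by
    refine sum_congr rfl fun n _ => ?_
    simp only [hf, hg, ← expPhase_add]
    congr 1
    rw [eval_sub, eval_monomial, hγ]
    field_simp
    ring
  have h2 : ∑ n ∈ range N, f n * expPhase (b * ((n : ℝ) / q)) =
      ∑ n ∈ range N, expPhase (γ * (n : ℝ) ^ k) * expPhase (R.eval (n : ℝ)) := by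
    refine sum_congr rfl fun n _ => ?_
    simp only [hf, hR, ← expPhase_add]
    congr 1
    rw [eval_add, eval_monomial]
    ring
  -- Summation by parts needs a bound for all partial sums, so the length drops to the one with the
  -- largest sum.
  obtain ⟨m, hm, hmax⟩ := exists_max_image (range (N + 1)) (fun m => ‖weylSum R m‖) ⟨0, by simp⟩
  refine ⟨b, m, Nat.lt_succ_iff.1 (mem_range.1 hm), ?_⟩
  have h3 := norm_sum_mul_le_of_variation (fun n => expPhase (R.eval (n : ℝ)))
    (fun n => expPhase (γ * (n : ℝ) ^ k)) N (B := ‖weylSum R m‖)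
    (fun m' hm' => hmax m' (mem_range.2 (by omega))) (fun n => (norm_expPhase _).le)
    (sum_norm_expPhase_monomial_variation_le γ k N)
  rw [← h2] at h3
  have hvar : 1 + 2 * Real.pi * |γ| * (N : ℝ) ^ k ≤ 8 * A := by
    have := Real.pi_lt_d2
    have h4 : 2 * Real.pi * (|γ| * (N : ℝ) ^ k) ≤ 7 * A := by
      gcongr
      linarith
    linarith
  calc (N : ℝ) ≤ T * ‖weylSum Q N‖ := hS
    _ ≤ T * (A * (‖weylSum R m‖ * (8 * A))) := by
        rw [h1]
        gcongr
        exact hb.trans (by gcongr; exact h3.trans (by gcongr))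
    _ = _ := by ring

open Polynomial in
theorem WeylInverse.succ_linear {k : ℕ} (hk1 : 1 ≤ k) (hk : WeylInverse k 1) :
    WeylInverse (k + 1) 1 := by
  obtain ⟨C₁, hC₁⟩ := weylInverse_top (k + 1) (by omega)
  obtain ⟨C₂, hC₂⟩ := hk
  set E := 2 * C₁ + 4 with hE
  -- The exponent collects U ^ C₂ from the lower degree, one U from N ≤ U * m, and T ^ C₁ from
  -- clearing the denominator q of the shift.
  refine ⟨E * (C₂ + 1) + C₁, fun T N Q hT hN hQ hS => ?_⟩
  obtain ⟨q, hq0, hq, p, hp⟩ := hC₁ T N Q hT hN hQ hS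
  have hT0 : 0 < T := by linarith
  have hT1 : 1 ≤ T := by linarith
  obtain ⟨b, m, hmN, hm⟩ := exists_lower_degree_large_weylSum
    (one_le_pow₀ hT1) hq0 hq hp hT0 hS
  set R := Q - monomial (k + 1) (Q.coeff (k + 1)) + monomial 1 ((b : ℝ) / q) with hR
  have hUE : 8 * T * (T ^ C₁) ^ 2 ≤ T ^ E := by
    calc 8 * T * (T ^ C₁) ^ 2 = 2 ^ 3 * (T * (T ^ C₁) ^ 2) := by ring
      _ ≤ T ^ 3 * (T * (T ^ C₁) ^ 2) := by gcongr
      _ = T ^ E := by rw [hE]; ring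
  set U := T ^ E with hU
  have hU2 : 2 ≤ U := hT.trans (le_self_pow₀ hT1 (by omega))
  have hNU : (N : ℝ) ≤ U * ‖weylSum R m‖ := hm.trans (by gcongr)
  have hNm : (N : ℝ) ≤ U * m := hNU.trans (by gcongr; exact norm_weylSum_le _ _)
  have hm1 : 1 ≤ m := by
    rcases Nat.eq_zero_or_pos m with h0 | h0
    · rw [h0] at hNm
      have : (1 : ℝ) ≤ N := by exact_mod_cast hN
      simp at hNm
      omega
    · exact h0
  have hRdeg : R.natDegree ≤ k := by
    rw [natDegree_le_iff_coeff_eq_zero]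
    intro n hn
    rw [hR, coeff_add, coeff_sub, coeff_monomial, coeff_monomial, if_neg (by omega : ¬ 1 = n)]
    split_ifs with h
    · rw [← h]; ring
    · rw [coeff_eq_zero_of_natDegree_lt (by omega)]; ring
  have hR1 : R.coeff 1 = Q.coeff 1 + b / q := by
    rw [hR, coeff_add, coeff_sub, coeff_monomial, coeff_monomial, if_pos rfl,
      if_neg (by omega : ¬ k + 1 = 1)]
    ring
  obtain ⟨q', hq'0, hq', p', hp'⟩ := hC₂ U m R hU2 hm1 hRdeg
    (le_trans (by exact_mod_cast hmN) hNU)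
  rw [hR1, pow_one] at hp'
  have hq0' : (0 : ℝ) < q := by exact_mod_cast hq0
  refine ⟨q * q', by positivity, ?_, q * p' - q' * b, ?_⟩
  · push_cast
    rw [pow_add, mul_comm, pow_mul]
    gcongr
    exact hq'.trans (pow_le_pow_right₀ (by linarith) (by omega))
  · have h1 : ((q * q' : ℕ) : ℝ) * Q.coeff 1 - (q * p' - q' * b : ℤ) =
        q * (q' * (Q.coeff 1 + b / q) - p') := by
      push_cast; field_simp; ring
    rw [h1, abs_mul, Nat.abs_cast, pow_one, pow_add, pow_mul, ← hU]
    calc _ ≤ q * |q' * (Q.coeff 1 + b / q) - p'| * (U * m) := by gcongr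
      _ = U * (|q' * (Q.coeff 1 + b / q) - p'| * m) * q := by ring
      _ ≤ U * U ^ C₂ * T ^ C₁ := by gcongr
      _ = _ := by ring

theorem weylInverse_linear (k : ℕ) (hk : 1 ≤ k) : WeylInverse k 1 := by
  induction k, hk using Nat.le_induction with
  | base => exact weylInverse_one_one
  | succ k hk ih => exact ih.succ_linear hk

/-! ### Power saving for a non-Liouville linear coefficient -/

theorem exists_pow_lower_bound_of_not_isLiouvilleNumber {α : ℝ} (hα : ¬ IsLiouvilleNumber α) :
    ∃ m : ℕ, ∀ q : ℕ, 0 < q → ∀ p : ℤ, 1 ≤ |q * α - p| * (2 * q : ℝ) ^ m := by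
  simp only [IsLiouvilleNumber] at hα
  push Not at hα
  obtain ⟨m, hm⟩ := hα
  refine ⟨m, fun q hq p => ?_⟩
  have hq1 : (1 : ℝ) ≤ q := by exact_mod_cast hq
  -- Doubling the fraction meets the requirement that the denominator exceed 1, so q = 1 is covered.
  have h1 := hm (2 * p) (2 * q) (by omega)
  have h2 : α - ((2 * p : ℤ) : ℝ) / ((2 * q : ℤ) : ℝ) = (q * α - p) / q := by
    push_cast
    field_simp
  rw [h2, abs_div, Nat.abs_cast, zpow_neg, zpow_natCast] at h1
  push_cast at h1
  rw [inv_lt_iff_one_lt_mul₀ (by positivity)] at h1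
  calc 1 ≤ |q * α - p| / q * (2 * q : ℝ) ^ m := by linarith
    _ ≤ _ := by gcongr; exact div_le_self (abs_nonneg _) hq1

open Polynomial in
/-- Weyl sums of polynomials with a fixed non-Liouville linear coefficient, and of their small
multiples, save a power, uniformly in the other coefficients. -/
theorem exists_pow_weylSum_lt {α : ℝ} (hα : ¬ IsLiouvilleNumber α) {k : ℕ} (hk : 1 ≤ k) :
    ∃ E : ℕ, ∀ (T : ℝ) (N h : ℕ) (R : ℝ[X]), 2 ≤ T → 1 ≤ N → R.natDegree ≤ k →
      R.coeff 1 = α → 0 < h → h ≤ T → T ^ E < N → T * ‖weylSum (C (h : ℝ) * R) N‖ < N := by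
  obtain ⟨m, hm⟩ := exists_pow_lower_bound_of_not_isLiouvilleNumber hα
  obtain ⟨c, hc⟩ := weylInverse_linear k hk
  -- The denominator met below is 2qh, at most T · T ^ c · T, and it enters to the power m.
  refine ⟨c + (c + 2) * m, fun T N h R hT hN hR hRα hh hhT hTN => ?_⟩
  by_contra! hcon
  obtain ⟨q, hq0, hq, p, hp⟩ := hc T N (C (h : ℝ) * R) hT hN
    ((natDegree_C_mul_le _ _).trans hR) hcon
  rw [coeff_C_mul, hRα, pow_one] at hp
  have h1 := hm (q * h) (by positivity) p
  push_cast at h1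
  rw [mul_assoc (q : ℝ) h α] at h1
  refine hTN.not_ge ?_
  calc (N : ℝ) ≤ N * (|q * (h * α) - p| * (2 * (q * h) : ℝ) ^ m) :=
        le_mul_of_one_le_right (by positivity) h1
    _ = (|q * (h * α) - p| * N) * (2 * (q * h) : ℝ) ^ m := by ring
    _ ≤ T ^ c * (T * (T ^ c * T)) ^ m := by gcongr
    _ = _ := by rw [pow_add, pow_mul]; ring

/-! ### Sawtooth sums -/

/-- The sawtooth function. -/
noncomputable def sawtooth (x : ℝ) : ℝ := Int.fract x - 1 / 2

theorem abs_sawtooth_le (x : ℝ) : |sawtooth x| ≤ 1 / 2 := by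
  have h1 := Int.fract_nonneg x
  have h2 := (Int.fract_lt_one x).le
  rw [sawtooth, abs_le]
  constructor <;> linarith

/-- The squared sawtooth is the lower envelope of the integer translates of one parabola. -/
theorem sawtooth_sq_le (x : ℝ) (m : ℤ) : sawtooth x ^ 2 ≤ (x - m - 1 / 2) ^ 2 := by
  have h1 := Int.fract_nonneg x
  have h2 := (Int.fract_lt_one x).le
  have h3 : x - m - 1 / 2 = sawtooth x + ((⌊x⌋ - m : ℤ) : ℝ) := by
    rw [sawtooth, Int.fract]; push_cast; ring
  rw [h3]
  generalize ⌊x⌋ - m = j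
  have h4 : 0 ≤ (j : ℝ) * (2 * sawtooth x + j) := by
    rw [sawtooth]
    rcases lt_trichotomy j 0 with h | h | h
    · have : (j : ℝ) ≤ -1 := by exact_mod_cast Int.le_sub_one_of_lt h
      exact mul_nonneg_of_nonpos_of_nonpos (by linarith) (by linarith)
    · simp [h]
    · have : (1 : ℝ) ≤ j := by exact_mod_cast h
      exact mul_nonneg (by linarith) (by linarith)
  linarith [h4]

/-- Keeping the parabola of x after translation by t gives a one-sided expansion with no exception
at the jumps. -/
theorem sawtooth_sq_add_le (x t : ℝ) :
    sawtooth (x + t) ^ 2 ≤ sawtooth x ^ 2 + 2 * t * sawtooth x + t ^ 2 := by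
  refine (sawtooth_sq_le (x + t) ⌊x⌋).trans_eq ?_
  rw [sawtooth, Int.fract]
  ring

theorem indicator_fract_lt_eq (y : ℝ) {c : ℝ} (hc0 : 0 < c) (hc1 : c ≤ 1) :
    (if Int.fract y < c then (1 : ℝ) else 0) = c + sawtooth (y - c) - sawtooth y := by
  have h0 := Int.fract_nonneg y
  have h1 := Int.fract_lt_one y
  simp only [sawtooth]
  split_ifs with h
  · have : Int.fract (y - c) = Int.fract y - c + 1 := by
      rw [Int.fract_eq_iff]
      refine ⟨by linarith, by linarith, ⌊y⌋ - 1, ?_⟩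
      rw [Int.fract]; push_cast; ring
    rw [this]; ring
  · have : Int.fract (y - c) = Int.fract y - c := by
      rw [Int.fract_eq_iff]
      refine ⟨by linarith, by linarith, ⌊y⌋, ?_⟩
      rw [Int.fract]; ring
    rw [this]; ring

/-- Up to the constant 1/12 the squared sawtooth is the second Bernoulli polynomial of the
fractional part. -/
theorem hasSum_cos_sawtooth_sq (x : ℝ) :
    HasSum (fun h : ℕ => 1 / (h : ℝ) ^ 2 * (expPhase (h * x)).re)
      (Real.pi ^ 2 * (sawtooth x ^ 2 - 1 / 12)) := by
  have h1 := hasSum_one_div_nat_pow_mul_cos (k := 1) one_ne_zero (x := Int.fract x)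
    ⟨Int.fract_nonneg x, (Int.fract_lt_one x).le⟩
  convert h1 using 1
  · funext h
    congr 1
    have h2 : expPhase (h * x) = expPhase (h * Int.fract x) := by
      rw [← expPhase_sub_int (h * x) (h * ⌊x⌋), Int.fract]
      push_cast
      ring_nf
    rw [h2, expPhase, mul_comm, Complex.exp_ofReal_mul_I_re]
    ring_nf
  · simp [sawtooth, Polynomial.bernoulli, sum_range_succ, bernoulli, bernoulli'_two]
    ring

open Polynomial in
theorem exists_abs_sum_sawtooth_sq_le {α : ℝ} (hα : ¬ IsLiouvilleNumber α) {k : ℕ} (hk : 1 ≤ k) :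
    ∃ (E : ℕ) (K : ℝ), 0 ≤ K ∧ ∀ (s : ℝ) (N : ℕ) (R : ℝ[X]), 2 ≤ s → 1 ≤ N → R.natDegree ≤ k →
      R.coeff 1 = α → s ^ E < N →
      |∑ n ∈ range N, (sawtooth (R.eval (n : ℝ)) ^ 2 - 1 / 12)| ≤ K * N / s ^ 2 := by
  obtain ⟨E, hE⟩ := exists_pow_weylSum_lt hα hk
  have hsum : Summable (fun h : ℕ => 1 / (h : ℝ) ^ 2 * √h) := by
    refine (Real.summable_nat_rpow.2 (by norm_num : (-(3 / 2) : ℝ) < -1)).congr fun h => ?_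
    rcases Nat.eq_zero_or_pos h with rfl | hh
    · norm_num
    · have : (0 : ℝ) < h := by exact_mod_cast hh
      rw [Real.sqrt_eq_rpow, one_div, ← Real.rpow_natCast, ← Real.rpow_neg this.le,
        ← Real.rpow_add this]
      norm_num
  refine ⟨4 * E, ∑' h : ℕ, 1 / (h : ℝ) ^ 2 * √h, tsum_nonneg fun h => by positivity,
    fun s N R hs hN hR hRα hsN => ?_⟩
  have hs0 : 0 < s := by linarith
  have hfou := hasSum_sum (f := fun (n : ℕ) (h : ℕ) =>
    1 / (h : ℝ) ^ 2 * (expPhase (h * R.eval (n : ℝ))).re) (s := range N)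
    (fun n _ => hasSum_cos_sawtooth_sq (R.eval (n : ℝ)))
  rw [← mul_sum] at hfou
  have hbd : ∀ h : ℕ, ‖∑ n ∈ range N, 1 / (h : ℝ) ^ 2 * (expPhase (h * R.eval (n : ℝ))).re‖ ≤
      (N / s ^ 2) * (1 / (h : ℝ) ^ 2 * √h) := by
    intro h
    -- The frequency 0 contributes nothing, since 1 / 0 ^ 2 = 0.
    rcases Nat.eq_zero_or_pos h with rfl | hh
    · simp
    have h1 : ∑ n ∈ range N, 1 / (h : ℝ) ^ 2 * (expPhase (h * R.eval (n : ℝ))).re =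
        1 / (h : ℝ) ^ 2 * (weylSum (C (h : ℝ) * R) N).re := by
      rw [← mul_sum, weylSum, Complex.re_sum]
      simp
    have h2 : ‖weylSum (C (h : ℝ) * R) N‖ ≤ N / s ^ 2 * √h := by
      -- Up to s ^ 4 the Weyl bound with T = s ^ 4 applies, whence the exponent 4 * E. Beyond it the
      -- trivial bound suffices: √h ≥ s ^ 2, and the series still converges with the weight √h.
      rcases le_or_gt (h : ℝ) (s ^ 4) with hle | hgt
      · have h3 := hE (s ^ 4) N h R (hs.trans (le_self_pow₀ (by linarith) (by norm_num))) hN hR hRα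
          hh hle (by rwa [← pow_mul])
        have h4 : 1 ≤ √h := Real.one_le_sqrt.2 (by exact_mod_cast hh)
        have h5 : s ^ 2 ≤ s ^ 4 := pow_le_pow_right₀ (by linarith) (by norm_num)
        calc _ ≤ (N : ℝ) / s ^ 4 := by
              rw [le_div_iff₀ (by positivity), mul_comm]; exact h3.le
          _ ≤ N / s ^ 2 := by gcongr
          _ ≤ _ := le_mul_of_one_le_right (by positivity) h4
      · have h4 : s ^ 2 ≤ √h := Real.le_sqrt_of_sq_le (by rw [← pow_mul]; exact hgt.le)
        calc _ ≤ (N : ℝ) := norm_weylSum_le _ _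
          _ = N / s ^ 2 * s ^ 2 := by field_simp
          _ ≤ _ := by gcongr
    rw [h1, norm_mul, Real.norm_of_nonneg (by positivity), Real.norm_eq_abs]
    calc _ ≤ 1 / (h : ℝ) ^ 2 * (N / s ^ 2 * √h) := by
          gcongr
          exact (Complex.abs_re_le_norm _).trans h2
      _ = _ := by ring
  have h1 := tsum_of_norm_bounded (hsum.hasSum.mul_left ((N : ℝ) / s ^ 2)) hbd
  rw [hfou.tsum_eq, Real.norm_eq_abs, abs_mul, abs_of_pos (by positivity)] at h1
  have hpi : 1 ≤ Real.pi ^ 2 := one_le_pow₀ (by linarith [Real.pi_gt_three])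
  calc _ ≤ Real.pi ^ 2 * |∑ n ∈ range N, (sawtooth (R.eval (n : ℝ)) ^ 2 - 1 / 12)| :=
        le_mul_of_one_le_left (abs_nonneg _) hpi
    _ ≤ _ := h1
    _ = _ := by ring

-- Adding a constant t keeps the linear coefficient, so both squared sums have the same main term
-- and the linear term of `sawtooth_sq_add_le` is isolated. The choices t = ±1/s bound it from both
-- sides.
open Polynomial in
theorem exists_abs_sum_sawtooth_le_div {α : ℝ} (hα : ¬ IsLiouvilleNumber α) {k : ℕ} (hk : 1 ≤ k) :
    ∃ (E : ℕ) (K : ℝ), 0 ≤ K ∧ ∀ (s : ℝ) (N : ℕ) (R : ℝ[X]), 2 ≤ s → 1 ≤ N → R.natDegree ≤ k →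
      R.coeff 1 = α → s ^ E < N →
      |∑ n ∈ range N, sawtooth (R.eval (n : ℝ))| ≤ K * N / s := by
  obtain ⟨E, K, hK, h⟩ := exists_abs_sum_sawtooth_sq_le hα hk
  refine ⟨E, K + 1 / 2, by positivity, fun s N R hs hN hR hRα hsN => ?_⟩
  have hs0 : 0 < s := by linarith
  have key : ∀ t : ℝ, t ^ 2 = 1 / s ^ 2 →
      -(t * ∑ n ∈ range N, sawtooth (R.eval (n : ℝ))) ≤ (K + 1 / 2) * N / s ^ 2 := by
    intro t ht
    have h1 := (abs_le.1 (h s N R hs hN hR hRα hsN)).2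
    have h2 := (abs_le.1 (h s N (R + C t) hs hN
      (by rwa [natDegree_add_C]) (by rw [coeff_add, coeff_C]; simpa using hRα) hsN)).1
    have h3 : ∑ n ∈ range N, (sawtooth ((R + C t).eval (n : ℝ)) ^ 2 - 1 / 12) ≤
        ∑ n ∈ range N, ((sawtooth (R.eval (n : ℝ)) ^ 2 - 1 / 12) +
          (2 * t * sawtooth (R.eval (n : ℝ)) + t ^ 2)) := by
      refine sum_le_sum fun n _ => ?_
      have := sawtooth_sq_add_le (R.eval (n : ℝ)) t
      rw [eval_add, eval_C]
      linarith
    rw [sum_add_distrib, sum_add_distrib, ← mul_sum, sum_const, card_range, nsmul_eq_mul, ht] at h3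
    have h4 : (K + 1 / 2) * N / s ^ 2 = K * N / s ^ 2 + N * (1 / s ^ 2) / 2 := by ring
    rw [h4]
    linarith
  have h1 := key (1 / s) (by rw [div_pow, one_pow])
  have h2 := key (-(1 / s)) (by rw [neg_sq, div_pow, one_pow])
  have h3 : 1 / s * |∑ n ∈ range N, sawtooth (R.eval (n : ℝ))| ≤ (K + 1 / 2) * N / s ^ 2 := by
    have h4 : 0 < 1 / s := by positivity
    have h5 := abs_mul (1 / s) (∑ n ∈ range N, sawtooth (R.eval (n : ℝ)))
    rw [abs_of_pos h4] at h5
    rw [← h5, abs_le]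
    constructor <;> linarith
  calc _ = s * (1 / s * |∑ n ∈ range N, sawtooth (R.eval (n : ℝ))|) := by field_simp
    _ ≤ s * ((K + 1 / 2) * N / s ^ 2) := by gcongr
    _ = _ := by field_simp

open Polynomial in
theorem exists_abs_sum_sawtooth_le {α : ℝ} (hα : ¬ IsLiouvilleNumber α) {k : ℕ} (hk : 1 ≤ k) :
    ∃ ν K : ℝ, 0 < ν ∧ ν ≤ 1 ∧ 0 < K ∧ ∀ (N : ℕ) (R : ℝ[X]), 1 ≤ N → R.natDegree ≤ k →
      R.coeff 1 = α → |∑ n ∈ range N, sawtooth (R.eval (n : ℝ))| ≤ K * (N : ℝ) ^ (1 - ν) := by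
  obtain ⟨E, K, hK, h⟩ := exists_abs_sum_sawtooth_le_div hα hk
  refine ⟨1 / (E + 1 : ℕ), K + 2, by positivity, ?_, by positivity, fun N R hN hR hRα => ?_⟩
  · rw [div_le_one (by positivity)]; push_cast; linarith [Nat.cast_nonneg (α := ℝ) E]
  set ν : ℝ := 1 / (E + 1 : ℕ) with hν
  have hN0 : (0 : ℝ) < N := by exact_mod_cast hN
  have hsplit : (N : ℝ) / (N : ℝ) ^ ν = (N : ℝ) ^ (1 - ν) := by
    rw [Real.rpow_sub hN0, Real.rpow_one]
  have hspos : 0 < (N : ℝ) ^ ν := by positivity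
  have hpos : 0 < (N : ℝ) ^ (1 - ν) := by positivity
  -- The parameter is s = N ^ ν with ν = 1/(E + 1), so that s ^ E < s ^ (E + 1) = N; when s < 2 the
  -- trivial bound is enough.
  rcases lt_or_ge ((N : ℝ) ^ ν) 2 with hlt | hge
  · have h1 : |∑ n ∈ range N, sawtooth (R.eval (n : ℝ))| ≤ N := by
      refine (abs_sum_le_sum_abs _ _).trans ?_
      calc _ ≤ ∑ n ∈ range N, (1 : ℝ) :=
            sum_le_sum fun n _ => (abs_sawtooth_le _).trans (by norm_num)
        _ = N := by simp
    have h2 : (N : ℝ) = (N : ℝ) ^ ν * (N : ℝ) ^ (1 - ν) := by rw [← hsplit]; field_simp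
    calc _ ≤ (N : ℝ) := h1
      _ = (N : ℝ) ^ ν * (N : ℝ) ^ (1 - ν) := h2
      _ ≤ (K + 2) * (N : ℝ) ^ (1 - ν) := by gcongr; linarith
  · have h1 : ((N : ℝ) ^ ν) ^ (E + 1) = N := by
      rw [hν, one_div, Real.rpow_inv_natCast_pow hN0.le (by omega)]
    have h2 : ((N : ℝ) ^ ν) ^ E < N := by
      conv_rhs => rw [← h1]
      exact pow_lt_pow_right₀ (by linarith) (by omega)
    refine (h _ N R hge hN hR hRα h2).trans ?_
    rw [mul_div_assoc, hsplit]
    gcongr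
    linarith

/-! ### Reduction to fractional parts and the final count -/

theorem natCast_dvd_floor_iff {d : ℕ} (hd : 0 < d) (y : ℝ) :
    (d : ℤ) ∣ ⌊y⌋ ↔ Int.fract (y / d) < 1 / d := by
  have hd' : (0 : ℝ) < d := by exact_mod_cast hd
  have h1 : Int.fract (y / d) < 1 / d ↔ y < d * ⌊y / d⌋ + 1 := by
    rw [Int.fract, sub_lt_iff_lt_add, ← sub_pos, ← sub_pos (a := _ + 1),
      ← mul_pos_iff_of_pos_left (b := 1 / d + ⌊y / d⌋ - y / d) hd']
    have : d * (1 / d + ⌊y / d⌋ - y / d) = d * ⌊y / d⌋ + 1 - y := by field_simp; ring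
    rw [this]
  have h2 : d * (⌊y / d⌋ : ℝ) ≤ y := by
    have := Int.floor_le (y / d)
    rw [le_div_iff₀ hd'] at this
    linarith
  rw [h1]
  constructor
  · rintro ⟨t, ht⟩
    have h3 : ⌊y / d⌋ = t := by
      rw [Int.floor_div_natCast, ht, Int.mul_ediv_cancel_left _ (by omega)]
    rw [h3]
    have := Int.lt_floor_add_one y
    rw [ht] at this
    exact_mod_cast this
  · intro h
    refine ⟨⌊y / d⌋, ?_⟩
    rw [Int.floor_eq_iff]
    push_cast
    exact ⟨h2, h⟩

/-- The polynomial `P(dx) / d`. -/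
noncomputable def dilated (P : Polynomial ℝ) (d : ℕ) : Polynomial ℝ :=
  Polynomial.C (d : ℝ)⁻¹ * P.comp (Polynomial.C (d : ℝ) * Polynomial.X)

theorem eval_dilated (P : Polynomial ℝ) (d : ℕ) (x : ℝ) :
    (dilated P d).eval x = P.eval (d * x) / d := by
  simp [dilated]; ring

theorem natDegree_dilated_le (P : Polynomial ℝ) (d : ℕ) : (dilated P d).natDegree ≤ P.natDegree := by
  refine (Polynomial.natDegree_C_mul_le _ _).trans (Polynomial.natDegree_comp_le.trans ?_)
  calc _ ≤ P.natDegree * 1 := Nat.mul_le_mul_left _ ((Polynomial.natDegree_C_mul_le _ _).trans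
        Polynomial.natDegree_X_le)
    _ = _ := mul_one _

/-- The dilation by d and the division by d cancel exactly in degree 1; this is why only the linear
coefficient carries a hypothesis. -/
theorem coeff_one_dilated (P : Polynomial ℝ) {d : ℕ} (hd : 0 < d) :
    (dilated P d).coeff 1 = P.coeff 1 := by
  rw [dilated, Polynomial.coeff_C_mul, Polynomial.comp_C_mul_X_coeff, pow_one]
  field_simp

theorem card_divGcdSet_eq (P : Polynomial ℝ) {d : ℕ} (hd : 0 < d) (X : ℝ) :
    #(divGcdSet P d X) =
      #{m ∈ Icc 1 ⌊X / d⌋₊ | Int.fract ((dilated P d).eval ((m : ℕ) : ℝ)) < 1 / d} := by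
  have hd' : (0 : ℝ) < d := by exact_mod_cast hd
  symm
  refine card_bij (fun m _ => d * m) ?_ (fun a _ b _ hab => Nat.eq_of_mul_eq_mul_left hd hab) ?_
  · intro m hm
    rw [mem_filter, mem_Icc] at hm
    obtain ⟨⟨hm1, hm2⟩, hm3⟩ := hm
    rw [eval_dilated, ← natCast_dvd_floor_iff hd] at hm3
    rw [mem_divGcdSet]
    refine ⟨Nat.mul_pos hd hm1, ?_, Int.natCast_dvd_natCast.1 (Int.dvd_coe_gcd ?_ ?_)⟩
    · rw [Nat.le_floor_iff' (by omega), le_div_iff₀ hd'] at hm2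
      push_cast
      linarith
    · exact_mod_cast Nat.dvd_mul_right d m
    · push_cast
      exact hm3
  · intro x hx
    rw [mem_divGcdSet] at hx
    obtain ⟨hx1, hx2, hx3⟩ := hx
    have h1 := (Int.natCast_dvd_natCast.2 hx3).trans (Int.gcd_dvd_left _ _)
    have h2 := (Int.natCast_dvd_natCast.2 hx3).trans (Int.gcd_dvd_right _ _)
    obtain ⟨m, rfl⟩ := Int.natCast_dvd_natCast.1 h1
    have hm : m ≠ 0 := by rintro rfl; simp at hx1
    refine ⟨m, ?_, rfl⟩
    rw [mem_filter, mem_Icc, eval_dilated, ← natCast_dvd_floor_iff hd,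
      Nat.le_floor_iff' hm, le_div_iff₀ hd']
    push_cast at hx2 h2
    exact ⟨⟨Nat.one_le_iff_ne_zero.2 hm, by linarith⟩, h2⟩

theorem abs_card_fract_lt_sub_le {R : Polynomial ℝ} {c B : ℝ} {N : ℕ} (hc0 : 0 < c) (hc1 : c ≤ 1)
    (h0 : |∑ n ∈ range N, sawtooth (R.eval (n : ℝ))| ≤ B)
    (h1 : |∑ n ∈ range N, sawtooth ((R - Polynomial.C c).eval (n : ℝ))| ≤ B) :
    |(#{n ∈ range N | Int.fract (R.eval ((n : ℕ) : ℝ)) < c} : ℝ) - c * N| ≤ 2 * B := by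
  rw [card_filter]
  push_cast
  have h2 : ∑ n ∈ range N, (if Int.fract (R.eval (n : ℝ)) < c then (1 : ℝ) else 0) - c * N =
      ∑ n ∈ range N, sawtooth ((R - Polynomial.C c).eval (n : ℝ)) -
        ∑ n ∈ range N, sawtooth (R.eval (n : ℝ)) := by
    simp only [indicator_fract_lt_eq _ hc0 hc1]
    rw [sum_sub_distrib, sum_add_distrib]
    simp
    ring
  rw [h2]
  exact (abs_sub _ _).trans (by linarith)

theorem card_filter_Icc_one_sub (p : ℕ → Prop) [DecidablePred p] (n : ℕ) :
    |(#{m ∈ Icc 1 n | p m} : ℝ) - #{m ∈ range (n + 1) | p m}| ≤ 1 := by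
  have h1 : range (n + 1) = insert 0 (Icc 1 n) := by
    ext m; simp only [mem_range, mem_insert, mem_Icc]; omega
  have h2 : #{m ∈ Icc 1 n | p m} ≤ #{m ∈ range (n + 1) | p m} := by
    rw [h1]; exact card_le_card (filter_subset_filter _ (subset_insert _ _))
  have h3 : #{m ∈ range (n + 1) | p m} ≤ #{m ∈ Icc 1 n | p m} + 1 := by
    rw [h1, filter_insert]
    split_ifs
    · exact card_insert_le _ _
    · omega
  have h2' : (#{m ∈ Icc 1 n | p m} : ℝ) ≤ #{m ∈ range (n + 1) | p m} := by exact_mod_cast h2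
  have h3' : (#{m ∈ range (n + 1) | p m} : ℝ) ≤ #{m ∈ Icc 1 n | p m} + 1 := by exact_mod_cast h3
  rw [abs_le]
  constructor <;> linarith

theorem mainTheorem3 (P : Polynomial ℝ) (hP : ¬ IsLiouvilleNumber (P.coeff 1)) :
    ∃ μ C₀ : ℝ, 0 < μ ∧ 0 < C₀ ∧
      ∀ d : ℕ, 1 ≤ d → ∀ X : ℝ, 0 < X →
        |((divGcdSet P d X).card : ℝ) - X / (d : ℝ) ^ 2| ≤ C₀ * (X / (d : ℝ)) ^ (1 - μ) := by
  obtain ⟨ν, K, hν0, hν1, hK, h⟩ :=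
    exists_abs_sum_sawtooth_le hP (k := max 1 P.natDegree) (le_max_left _ _)
  refine ⟨ν, 4 * K + 2, hν0, by positivity, fun d hd X hX => ?_⟩
  have hd0 : 0 < d := hd
  have hd1 : (1 : ℝ) ≤ d := by exact_mod_cast hd
  have hdpos : (0 : ℝ) < d := by linarith
  have hc1 : 1 / (d : ℝ) ≤ 1 := by rw [div_le_one hdpos]; exact hd1
  have hc0 : 0 < 1 / (d : ℝ) := by positivity
  rw [card_divGcdSet_eq P hd0]
  have hXd : X / (d : ℝ) ^ 2 = 1 / d * (X / d) := by field_simp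
  rw [hXd]
  have hM : 0 < X / d := by positivity
  set M := X / (d : ℝ)
  have hMpos : 0 < M ^ (1 - ν) := by positivity
  -- For M < 1 the set is empty and the main term M/d is at most M ≤ M ^ (1 - ν).
  rcases lt_or_ge M 1 with hM1 | hM1
  · have h0 : ⌊M⌋₊ = 0 := Nat.floor_eq_zero.2 hM1
    have h1 : M ≤ M ^ (1 - ν) := by
      conv_lhs => rw [← Real.rpow_one M]
      exact Real.rpow_le_rpow_of_exponent_ge hM hM1.le (by linarith)
    rw [h0]
    simp only [zero_lt_one, Icc_eq_empty_of_lt, filter_empty, card_empty, Nat.cast_zero, zero_sub,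
      abs_neg]
    rw [abs_of_pos (by positivity)]
    have h2 : 1 / d * M ≤ 1 * M := by gcongr
    have h3 : 0 ≤ K * M ^ (1 - ν) := by positivity
    linarith
  · have hMge : 1 ≤ M ^ (1 - ν) := Real.one_le_rpow hM1 (by linarith)
    -- The sums start at 0, hence the extra term. It costs 1 in the count and 1 in the main term,
    -- while N ≤ 2M doubles K; this gives 4 * K + 2.
    set N := ⌊M⌋₊ + 1 with hN
    have hNM : M ≤ N := by rw [hN]; push_cast; exact (Nat.lt_floor_add_one M).le
    have hNM1 : (N : ℝ) ≤ M + 1 := by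
      rw [hN]; push_cast; linarith [Nat.floor_le hM.le]
    have hN1 : 1 ≤ N := by omega
    have hdeg : (dilated P d).natDegree ≤ max 1 P.natDegree :=
      (natDegree_dilated_le P d).trans (le_max_right _ _)
    have hB : K * (N : ℝ) ^ (1 - ν) ≤ 2 * K * M ^ (1 - ν) := by
      have h1 : (N : ℝ) ^ (1 - ν) ≤ (2 * M) ^ (1 - ν) :=
        Real.rpow_le_rpow (by positivity) (by linarith) (by linarith)
      have h2 : (2 : ℝ) ^ (1 - ν) ≤ 2 := by
        conv_rhs => rw [← Real.rpow_one 2]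
        exact Real.rpow_le_rpow_of_exponent_le (by norm_num) (by linarith)
      rw [Real.mul_rpow (by norm_num) hM.le] at h1
      calc _ ≤ K * ((2 : ℝ) ^ (1 - ν) * M ^ (1 - ν)) := by gcongr
        _ ≤ K * (2 * M ^ (1 - ν)) := by gcongr
        _ = _ := by ring
    have h1 := abs_card_fract_lt_sub_le (R := dilated P d) hc0 hc1
      ((h N _ hN1 hdeg (coeff_one_dilated P hd0)).trans hB)
      ((h N _ hN1 (by rwa [Polynomial.natDegree_sub_C])
        (by rw [Polynomial.coeff_sub, Polynomial.coeff_C, coeff_one_dilated P hd0]; simp)).trans hB)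
    have h2 := card_filter_Icc_one_sub
      (fun m => Int.fract ((dilated P d).eval (m : ℝ)) < 1 / d) ⌊M⌋₊
    have h3 : |1 / (d : ℝ) * N - 1 / d * M| ≤ 1 := by
      rw [← mul_sub, abs_of_nonneg (mul_nonneg hc0.le (by linarith))]
      calc 1 / (d : ℝ) * (N - M) ≤ 1 * 1 :=
            mul_le_mul hc1 (by linarith) (by linarith) zero_le_one
        _ = 1 := one_mul 1
    rw [abs_le] at h1 h2 h3 ⊢
    constructor <;> linarith
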